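/- Let $q$ be a prime power and let $\ell, m_1,\dots,m_\ell,n_1,\dots,n_\ell$ be positive integers with $m_1\ge\dots\ge m_\ell$ and $n_i\le m_i$ for all $i$. Let $\mathbb M=\mathbb F_q^{m_1\times n_1}\times\dots\times\mathbb F_q^{m_\ell\times n_\ell}$. All codes are $\mathbb F_q$-linear subspaces. A code $\mathcal C\subseteq\mathbb M$ is called an optimal anticode if $$\dim_{\mathbb F_q}(\mathcal C)=\max\Big\{\sum_{i=1}^\ell m_i\,\mathrm{rk}(X_i) : (X_1,\dots,X_\ell)\in\mathcal C\Big\}.$$ For $b\le a$, a code $\mathcal D\subseteq\mathbb F_q^{a\times b}$ is an optimal rank-metric anticode if $\dim(\mathcal D)=a\cdot\max\{\mathrm{rk}(X):X\in\mathcal D\}$. A code $\mathcal C'\subseteq\mathbb F_q^{r}$ is an optimal Hamming-metric anticode if $\dim(\mathcal C')=\max\{\mathrm{wt}(x):x\in\mathcal C'\}$, where $\mathrm{wt}$ is the Hamming weight. Let $k=\max\{i\in\{1,\dots,\ell\}: m_i>1\}$, with $k=0$ if $m_1=\dots=m_\ell=1$. For $i>k$ one has $m_i=n_i=1$, so $\mathbb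 F_q^{m_{k+1}\times n_{k+1}}\times\dots\times\mathbb F_q^{m_\ell\times n_\ell}$ is identified with $\mathbb F_q^{\ell-k}$. **Theorem.** A code $\mathcal C\subseteq\mathbb M$ is an optimal anticode if and only if there are optimal rank-metric anticodes $\mathcal C_i\subseteq\mathbb F_q^{m_i\times n_i}$ for $i\in\{1,\dots,k\}$ and an optimal Hamming-metric anticode $\mathcal C'\subseteq\mathbb F_q^{\ell-k}$ such that $\mathcal C=\mathcal C_1\times\dots\times\mathcal C_k\times\mathcal C'$. -/

import Mathlib

/-- The ambient space `𝕄 = F^(m₁ × n₁) × ⋯ × F^(m_ℓ × n_ℓ)`. -/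
abbrev SumRankSpace (F : Type*) {ℓ : ℕ} (m n : Fin ℓ → ℕ) : Type _ :=
  (i : Fin ℓ) → Matrix (Fin (m i)) (Fin (n i)) F

/-- `C ⊆ 𝕄` is an optimal (sum-rank metric) anticode:
`dim C = max {∑ i, m i * rk (X i) : X ∈ C}`. -/
def IsOptimalSumRankAnticode {F : Type*} [Field F] {ℓ : ℕ} {m n : Fin ℓ → ℕ}
    (C : Submodule F (SumRankSpace F m n)) : Prop :=
  IsGreatest {w : ℕ | ∃ X ∈ C, w = ∑ i, m i * (X i).rank} (Module.finrank F C)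

/-- `C ⊆ F^(a × b)` (used for `b ≤ a`) is an optimal rank-metric anticode:
`dim C = a * max {rk X : X ∈ C}`. -/
def IsOptimalRankAnticode {F : Type*} [Field F] {a b : ℕ}
    (C : Submodule F (Matrix (Fin a) (Fin b) F)) : Prop :=
  IsGreatest {w : ℕ | ∃ X ∈ C, w = a * X.rank} (Module.finrank F C)

open Classical in
/-- `C ⊆ F^r` is an optimal Hamming-metric anticode: `dim C = max {wt x : x ∈ C}`. -/
def IsOptimalHammingAnticode {F : Type*} [Field F] {r : ℕ}
    (C : Submodule F (Fin r → F)) : Prop :=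
  IsGreatest {w : ℕ | ∃ x ∈ C, w = hammingNorm x} (Module.finrank F C)

/-- `k = max {i ∈ {1, …, ℓ} : m_i > 1}`, and `k = 0` if there is no such `i`.
The element `i : Fin ℓ` stands for the one-based index `i + 1`. -/
def lastBig {ℓ : ℕ} (m : Fin ℓ → ℕ) : ℕ :=
  (Finset.univ.filter fun i : Fin ℓ => 1 < m i).sup fun i => (i : ℕ) + 1

theorem lastBig_le {ℓ : ℕ} (m : Fin ℓ → ℕ) : lastBig m ≤ ℓ :=
  Finset.sup_le fun i _ => i.isLt

/-- The index `i ≤ k` of a block of the first kind. -/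
def headIdx {ℓ : ℕ} (m : Fin ℓ → ℕ) (i : Fin (lastBig m)) : Fin ℓ :=
  Fin.castLE (lastBig_le m) i

/-- The index `k + j` of a block after the `k`-th one. -/
def tailIdx {ℓ : ℕ} (m : Fin ℓ → ℕ) (j : Fin (ℓ - lastBig m)) : Fin ℓ :=
  ⟨lastBig m + j, by have := j.isLt; omega⟩

/-- All blocks after the `k`-th one are `1 × 1` matrices (when `n i ≤ m i` and all sizes are
positive). -/
theorem size_tailIdx {ℓ : ℕ} (m n : Fin ℓ → ℕ) [∀ i, NeZero (m i)] [∀ i, NeZero (n i)]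
    (hnm : ∀ i, n i ≤ m i) (j : Fin (ℓ - lastBig m)) :
    m (tailIdx m j) = 1 ∧ n (tailIdx m j) = 1 := by
  have h1 : ¬ 1 < m (tailIdx m j) := by
    intro h
    have : ((tailIdx m j : Fin ℓ) : ℕ) + 1 ≤ lastBig m :=
      Finset.le_sup (f := fun i : Fin ℓ => (i : ℕ) + 1) (by simpa using h)
    simp only [tailIdx] at this
    omega
  have h2 := hnm (tailIdx m j)
  have h3 := NeZero.ne (n (tailIdx m j))
  omega

/-- The tail `(X_{k+1}, …, X_ℓ)` of `X ∈ 𝕄` as a vector of `F^(ℓ - k)`: each of these blocks is a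
`1 × 1` matrix, identified with its only entry. -/
def tailVec {F : Type*} [Field F] {ℓ : ℕ} {m n : Fin ℓ → ℕ}
    [∀ i, NeZero (m i)] [∀ i, NeZero (n i)] :
    SumRankSpace F m n →ₗ[F] (Fin (ℓ - lastBig m) → F) where
  toFun X j := X (tailIdx m j) 0 0
  map_add' _ _ := rfl
  map_smul' _ _ := rfl

/-- The code `D₁ × ⋯ × D_k × C' ⊆ 𝕄`. -/
def prodCode {F : Type*} [Field F] {ℓ : ℕ} {m n : Fin ℓ → ℕ}
    [∀ i, NeZero (m i)] [∀ i, NeZero (n i)]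
    (D : (i : Fin (lastBig m)) →
      Submodule F (Matrix (Fin (m (headIdx m i))) (Fin (n (headIdx m i))) F))
    (C' : Submodule F (Fin (ℓ - lastBig m) → F)) :
    Submodule F (SumRankSpace F m n) where
  carrier := {X | (∀ i, X (headIdx m i) ∈ D i) ∧ tailVec X ∈ C'}
  add_mem' {X Y} hX hY :=
    ⟨fun i => (D i).add_mem (hX.1 i) (hY.1 i), by
      rw [map_add]; exact C'.add_mem hX.2 hY.2⟩
  zero_mem' := ⟨fun i => (D i).zero_mem, by rw [map_zero]; exact C'.zero_mem⟩
  smul_mem' c X hX :=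
    ⟨fun i => (D i).smul_mem c (hX.1 i), by
      rw [map_smul]; exact C'.smul_mem c hX.2⟩

/-!
The proof reads off everything from the *leading positions* of a code. Order the entries of a word of
`𝕄` by a weight which, inside each block, is the sum of a weight of the row and a weight of the
column, with no two entries of equal weight. The set of leading positions of `C` has
`dim C` elements (`finrank_le_ncard_leadingSet`, `ncard_leadingSet_le_finrank`).

If in each block a set of leading positions with distinct rows and distinct columns is given, then
one word of `C` has, in each block, at least the rank given by the size of that set
(`exists_card_le_rank`). This is a determinant computation: additivity of the weight makes
all but one term vanish in the sum of the determinants composed of one row of each of the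
corresponding words, and that sum is a combination of the determinants of subset sums
(`exists_det_sum_ne_zero`), which works over every field. Since an `m i × n i` grid is covered by
`m i` cyclic diagonals, some word `X` satisfies
`#(leading positions in block i) ≤ m i * rk (X i)` for all `i`. Summing over `i` gives the anticode
bound, and for an optimal anticode all these inequalities are equalities. So *for every additive
weight* the number of leading positions in block `i` is a multiple of `m i`
(`IsOptimalSumRankAnticode.dvd_ncard_leadingSet`).

Now let `m i > 1`, and list the entries of block `i` row by row, with all other blocks inserted after
the first `t` of these entries. Passing from `t` to `t + 1` changes the leading positions in block
`i` at most at one entry, so their number, being a multiple of `m i`, is constant. For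
`t = 0` it is the dimension of the subcode of `C` supported in block `i`, for large `t` that of the
projection of `C` to block `i`. Hence block `i` splits off (`IsOptimalSumRankAnticode.single_mem`).
Once `C` is a product, the anticode bounds for the factors show that each factor is optimal; the
converse is a dimension count.
-/

/-! ### Leading positions of a linear code -/

/-- The leading positions of the code `C`, whose words have coordinates `φ A : P → F`, when the
positions are ordered by the weight `w`: those `p` which are the first nonzero position of some
word of `C`. -/
def leadingSet {F V P : Type*} [Field F] [AddCommGroup V] [Module F V]
    (φ : V →ₗ[F] P → F) (w : P → ℕ) (C : Submodule F V) : Set P :=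
  {p | ∃ A ∈ C, φ A p ≠ 0 ∧ ∀ q, w q < w p → φ A q = 0}

/-- A word is determined by its entries at the leading positions: a nonzero difference of two words
would have its first nonzero entry there. -/
theorem finrank_le_ncard_leadingSet {F V P : Type*} [Field F] [AddCommGroup V] [Module F V]
    [Finite P] {φ : V →ₗ[F] P → F} {w : P → ℕ}
    (hφ : Function.Injective φ) (C : Submodule F V) :
    Module.finrank F C ≤ (leadingSet φ w C).ncard := by
  have := Fintype.ofFinite (leadingSet φ w C)
  let ψ : C →ₗ[F] (leadingSet φ w C → F) :=
    (LinearMap.funLeft F F (Subtype.val : leadingSet φ w C → P)) ∘ₗ φ ∘ₗ C.subtype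
  have hψ : Function.Injective ψ := by
    rw [← LinearMap.ker_eq_bot, LinearMap.ker_eq_bot']
    rintro ⟨A, hA⟩ h0
    by_contra hne
    have hφA : φ A ≠ 0 := fun h => hne (Subtype.ext (hφ (by simpa using h)))
    obtain ⟨p₀, hp₀⟩ := Function.ne_iff.1 hφA
    obtain ⟨p, hp, hmin⟩ := Set.exists_min_image {p | φ A p ≠ 0} w (Set.toFinite _) ⟨p₀, hp₀⟩
    have hmem : p ∈ leadingSet φ w C :=
      ⟨A, hA, hp, fun q hq => by
        by_contra hq0
        exact absurd (hmin q hq0) (not_le.2 hq)⟩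
    exact hp (congrFun h0 ⟨p, hmem⟩)
  have := LinearMap.finrank_le_finrank_of_injective hψ
  rwa [Module.finrank_fintype_fun_eq_card, ← Nat.card_eq_fintype_card,
    Nat.card_coe_set_eq] at this

/-- Words with distinct leading positions are in echelon form, hence linearly independent. -/
theorem ncard_leadingSet_le_finrank {F V P : Type*} [Field F] [AddCommGroup V] [Module F V]
    [FiniteDimensional F V] [Finite P] {φ : V →ₗ[F] P → F} {w : P → ℕ}
    (hw : Function.Injective w) (C : Submodule F V) :
    (leadingSet φ w C).ncard ≤ Module.finrank F C := by
  classical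
  have := Fintype.ofFinite (leadingSet φ w C)
  choose A hA hne hz using fun p : leadingSet φ w C => p.2
  have hli : LinearIndependent F (fun p => (⟨A p, hA p⟩ : C)) := by
    rw [Fintype.linearIndependent_iff]
    intro c hc
    by_contra! hcon
    obtain ⟨p₀, hp₀⟩ := hcon
    obtain ⟨p, hp, hmin⟩ := Set.exists_min_image {p : leadingSet φ w C | c p ≠ 0}
      (fun p => w p) (Set.toFinite _) ⟨p₀, hp₀⟩
    have h1 : ∑ q, c q * φ (A q) p = 0 := by
      have := congrArg (fun X : C => φ X p) hc
      simpa using this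
    rw [Finset.sum_eq_single p] at h1
    · exact mul_ne_zero hp (hne p) h1
    · intro q _ hqp
      by_cases hq : c q = 0
      · simp [hq]
      · have : w p ≠ w q := fun h => hqp (Subtype.ext (hw h.symm))
        rw [hz q p (lt_of_le_of_ne (hmin q hq) this), mul_zero]
    · simp
  have := hli.fintype_card_le_finrank
  rwa [← Nat.card_eq_fintype_card, Nat.card_coe_set_eq] at this

/-! ### Determinants of sums of matrices -/

/-- If `∑ det N ≠ 0`, where `N` ranges over the matrices composed of one row of each of the `M j`,
then some subset sum of the `M j` is nonsingular. (Expand the determinants of all subset sums by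
rows, and group the terms according to the set of matrices that contribute a row.) -/
theorem exists_det_sum_ne_zero {F κ : Type*} [Field F] [Fintype κ] [DecidableEq κ]
    (M : κ → Matrix κ κ F)
    (h : ∑ r : κ → κ with Finset.univ.image r = Finset.univ,
      (Matrix.of fun k l => M (r k) k l).det ≠ 0) :
    ∃ s : Finset κ, (∑ j ∈ s, M j).det ≠ 0 := by
  by_contra! hcon
  suffices H : ∀ s : Finset κ, ∑ r : κ → κ with Finset.univ.image r = s,
      (Matrix.of fun k l => M (r k) k l).det = 0 from h (H _)
  intro s
  induction s using Finset.strongInduction with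
  | H s ih =>
    have hexp : (∑ j ∈ s, M j).det =
        ∑ r ∈ Fintype.piFinset (fun _ : κ => s), (Matrix.of fun k l => M (r k) k l).det := by
      have := (Matrix.detRowAlternating (n := κ) (R := F)).toMultilinearMap.map_sum_finset
        (fun k j => M j k) (fun _ => s)
      convert this using 1
      · change _ = Matrix.det _
        congr 1
        ext k l
        simp [Matrix.sum_apply]
      · rfl
    rw [hcon s, ← Finset.sum_fiberwise_of_maps_to (t := s.powerset)
      (g := fun r => Finset.univ.image r)] at hexp
    · rw [Finset.sum_eq_single s] at hexp
      · rw [hexp]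
        refine Finset.sum_congr ?_ fun _ _ => rfl
        ext r
        simp only [Finset.mem_filter, Finset.mem_univ, true_and, Fintype.mem_piFinset]
        refine ⟨fun h => ⟨fun k => ?_, h⟩, fun h => h.2⟩
        rw [← h]
        exact Finset.mem_image_of_mem _ (Finset.mem_univ k)
      · intro u hu hus
        have hss := Finset.ssubset_iff_subset_ne.2 ⟨Finset.mem_powerset.1 hu, hus⟩
        rw [← ih u hss]
        refine Finset.sum_congr ?_ fun _ _ => rfl
        ext r
        simp only [Finset.mem_filter, Fintype.mem_piFinset]
        refine ⟨fun h => ⟨Finset.mem_univ _, h.2⟩, fun h => ⟨fun k => hss.1 ?_, h.2⟩⟩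
        rw [← h.2]
        exact Finset.mem_image_of_mem _ (Finset.mem_univ k)
      · simp
    · intro r hr
      rw [Finset.mem_powerset, Finset.image_subset_iff]
      exact fun k _ => Fintype.mem_piFinset.1 hr k

/-! ### Leading positions and ranks -/

/-- The positions of the entries of an element of `SumRankSpace F m n`: a block, together with a
row and a column of that block. -/
abbrev Position {ℓ : ℕ} (m n : Fin ℓ → ℕ) : Type :=
  Σ i, Fin (m i) × Fin (n i)

/-- The list of entries of an element of `SumRankSpace F m n`. -/
def entries {F : Type*} [Field F] {ℓ : ℕ} {m n : Fin ℓ → ℕ} :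
    SumRankSpace F m n →ₗ[F] Position m n → F where
  toFun X p := X p.1 p.2.1 p.2.2
  map_add' _ _ := rfl
  map_smul' _ _ := rfl

theorem entries_injective {F : Type*} [Field F] {ℓ : ℕ} {m n : Fin ℓ → ℕ} :
    Function.Injective (entries (F := F) (m := m) (n := n)) := by
  intro X Y h
  funext i
  ext r c
  exact congrFun h ⟨i, r, c⟩

/-- The weight of a position is the sum of a weight of its row and a weight of its column. -/
def positionWeight {ℓ : ℕ} {m n : Fin ℓ → ℕ} (a : (Σ i, Fin (m i)) → ℕ)
    (b : (Σ i, Fin (n i)) → ℕ) (p : Position m n) : ℕ :=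
  a ⟨p.1, p.2.1⟩ + b ⟨p.1, p.2.2⟩

/-- A set of leading positions with distinct rows and distinct columns forces large ranks, in all
blocks at once and by a single word. Let `A k` be a word with leading position `k`, and take the
square submatrix on the rows and columns concerned. A term of the expansion of a determinant made of
one row of each `A k` uses entries of `A k` of weight at least that of `k`; since the
weights are additive, both sides have the same total, so every entry used is the leading one. Hence
only the product of all leading entries survives. -/
theorem exists_card_le_rank {F : Type*} [Field F] {ℓ : ℕ} {m n : Fin ℓ → ℕ}
    {a : (Σ i, Fin (m i)) → ℕ} {b : (Σ i, Fin (n i)) → ℕ}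
    (hw : Function.Injective (positionWeight a b)) (C : Submodule F (SumRankSpace F m n))
    (T : ∀ i, Finset (Fin (m i) × Fin (n i)))
    (hrow : ∀ i, Set.InjOn Prod.fst (T i : Set (Fin (m i) × Fin (n i))))
    (hcol : ∀ i, Set.InjOn Prod.snd (T i : Set (Fin (m i) × Fin (n i))))
    (hT : ∀ i, ∀ p ∈ T i, (⟨i, p⟩ : Position m n) ∈ leadingSet entries (positionWeight a b) C) :
    ∃ X ∈ C, ∀ i, (T i).card ≤ (X i).rank := by
  classical
  let κ := {p : Position m n // p.2 ∈ T p.1}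
  let R : κ → Σ i, Fin (m i) := fun k => ⟨k.1.1, k.1.2.1⟩
  let K : κ → Σ i, Fin (n i) := fun k => ⟨k.1.1, k.1.2.2⟩
  have hR : Function.Injective R := by
    rintro ⟨⟨i, p⟩, hp⟩ ⟨⟨j, q⟩, hq⟩ h
    obtain rfl : i = j := congrArg Sigma.fst h
    have : p = q := hrow i hp hq (by simpa [R] using h)
    subst this
    rfl
  have hK : Function.Injective K := by
    rintro ⟨⟨i, p⟩, hp⟩ ⟨⟨j, q⟩, hq⟩ h
    obtain rfl : i = j := congrArg Sigma.fst h
    have : p = q := hcol i hp hq (by simpa [K] using h)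
    subst this
    rfl
  choose A hAC hA0 hAlt using fun k : κ => hT k.1.1 k.1.2 k.2
  let M : κ → Matrix κ κ F := fun k => (Matrix.blockDiagonal' (A k)).submatrix R K
  -- An entry of `M k` at `(x, y)` is either zero or an entry of `A k` not before its leading one.
  have hM : ∀ k x y : κ, M k x y ≠ 0 →
      positionWeight a b k.1 ≤ a (R x) + b (K y) ∧
        (a (R x) + b (K y) = positionWeight a b k.1 → R x = R k ∧ K y = K k) := by
    rintro k ⟨⟨i, r, c⟩, hx⟩ ⟨⟨j, r', c'⟩, hy⟩ h
    by_cases hij : i = j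
    · subst hij
      have h' : entries (A k) ⟨i, r, c'⟩ ≠ 0 := by
        exact fun h0 => h ((Matrix.blockDiagonal'_apply_eq (A k) i r c').trans h0)
      refine ⟨?_, fun he => ?_⟩
      · by_contra hlt
        exact h' (hAlt k ⟨i, r, c'⟩ (not_le.1 hlt))
      · have hk : (⟨i, r, c'⟩ : Position m n) = k.1 := hw he
        have hRK : R k = ⟨k.1.1, k.1.2.1⟩ ∧ K k = ⟨k.1.1, k.1.2.2⟩ := ⟨rfl, rfl⟩
        rw [← hk] at hRK
        exact ⟨hRK.1.symm, hRK.2.symm⟩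
    · exact absurd (Matrix.blockDiagonal'_apply_ne (A k) r c' hij) h
  have hterm : ∀ (r : κ → κ) (σ : Equiv.Perm κ), Function.Bijective r →
      (∀ x, M (r x) (σ x) x ≠ 0) → (∀ x, r x = x) ∧ σ = 1 := by
    intro r σ hr h
    have hle := fun x => (hM _ _ _ (h x)).1
    have hsum : ∑ x, positionWeight a b (r x).1 = ∑ x, (a (R (σ x)) + b (K x)) := by
      rw [Finset.sum_add_distrib, Equiv.sum_comp σ (fun x => a (R x)), ← Finset.sum_add_distrib]
      exact (Equiv.ofBijective r hr).sum_comp (fun x => positionWeight a b x.1)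
    have heq := (Finset.sum_eq_sum_iff_of_le fun x _ => hle x).1 hsum
    have hfin := fun x => (hM _ _ _ (h x)).2 (heq x (Finset.mem_univ x)).symm
    have hrx : ∀ x, r x = x := fun x => (hK (hfin x).2).symm
    refine ⟨hrx, Equiv.ext fun x => ?_⟩
    rw [hR (hfin x).1, hrx x]
    rfl
  obtain ⟨s, hs⟩ := exists_det_sum_ne_zero M (by
    rw [Finset.sum_eq_single id]
    · rw [Matrix.det_apply, Finset.sum_eq_single 1]
      · simp only [Equiv.Perm.sign_one, one_smul, Equiv.Perm.coe_one, id_eq, Matrix.of_apply]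
        refine Finset.prod_ne_zero_iff.2 fun k _ => ?_
        have : M k k k = entries (A k) k.1 :=
          Matrix.blockDiagonal'_apply_eq (A k) k.1.1 k.1.2.1 k.1.2.2
        rw [this]
        exact hA0 k
      · intro σ _ hσ
        by_contra h
        have hprod := Finset.prod_ne_zero_iff.1 (right_ne_zero_of_smul h)
        exact hσ (hterm σ σ σ.bijective fun x => hprod x (Finset.mem_univ x)).2
      · simp
    · intro r hr hrid
      have hsurj : Function.Surjective r := fun y => by
        have hy : y ∈ Finset.univ.image r := by
          rw [(Finset.mem_filter.1 hr).2]
          exact Finset.mem_univ y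
        simpa using hy
      rw [Matrix.det_apply]
      refine Finset.sum_eq_zero fun σ _ => ?_
      by_contra h
      have hprod := Finset.prod_ne_zero_iff.1 (right_ne_zero_of_smul h)
      obtain ⟨h1, rfl⟩ := hterm (r ∘ σ) σ
        ((Finite.injective_iff_bijective.1 (Finite.injective_iff_surjective.2 hsurj)).comp
          σ.bijective) fun x => hprod x (Finset.mem_univ x)
      exact hrid (funext h1)
    · simp)
  refine ⟨∑ j ∈ s, A j, C.sum_mem fun j _ => hAC j, fun i => ?_⟩
  set X := ∑ j ∈ s, A j with hX
  have hXM : (Matrix.blockDiagonal' X).submatrix R K = ∑ j ∈ s, M j := by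
    have := map_sum (Matrix.blockDiagonal'AddMonoidHom (fun i => Fin (m i)) (fun i => Fin (n i)) F)
      A s
    ext x y
    rw [Matrix.sum_apply]
    have h2 := congrFun (congrFun this (R x)) (K y)
    rw [Matrix.sum_apply] at h2
    exact h2
  rw [← hXM] at hs
  have hli := Matrix.linearIndependent_rows_of_det_ne_zero hs
  -- `Φ` sends the rows of `X i` to rows of the nonsingular submatrix, so that the former inherit
  -- linear independence.
  let Φ : (Fin (n i) → F) →ₗ[F] (κ → F) :=
    { toFun := fun v l => if h : i = (K l).1 then
        v (cast (congrArg (fun j => Fin (n j)) h.symm) (K l).2) else 0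
      map_add' := fun u v => by
        funext l
        by_cases h : i = (K l).1 <;> simp [h]
      map_smul' := fun t v => by
        funext l
        by_cases h : i = (K l).1 <;> simp [h] }
  have hcomp := hli.comp (fun p : T i => (⟨⟨i, p.1⟩, p.2⟩ : κ)) (by
    rintro ⟨p, hp⟩ ⟨q, hq⟩ h
    have h' : (⟨i, p⟩ : Position m n) = ⟨i, q⟩ := congrArg Subtype.val h
    exact Subtype.ext (eq_of_heq (Sigma.mk.inj h').2))
  have hrows : LinearIndependent F (fun p : T i => X i p.1.1) := by
    refine LinearIndependent.of_comp Φ ?_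
    exact hcomp
  have hspan := Matrix.rank_eq_finrank_span_row (X i)
  have hli2 := LinearIndependent.of_comp (Submodule.subtype _)
    (v := fun p : T i => (⟨X i p.1.1, Submodule.subset_span ⟨p.1.1, rfl⟩⟩ :
      Submodule.span F (Set.range (X i).row))) hrows
  have := hli2.fintype_card_le_finrank
  rwa [Fintype.card_coe, ← hspan] at this

/-! ### The anticode bound -/

/-- The cells of an `a × b` grid with `b ≤ a` are partitioned into `a` cyclic diagonals, each of
which meets every row and every column at most once. By the pigeonhole principle some diagonal
contains at least the fraction `1 / a` of `S`. -/
theorem exists_diagonal_subset {a b : ℕ} (hba : b ≤ a) (S : Finset (Fin a × Fin b)) :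
    ∃ T ⊆ S, Set.InjOn Prod.fst (T : Set (Fin a × Fin b)) ∧
      Set.InjOn Prod.snd (T : Set (Fin a × Fin b)) ∧ S.card ≤ a * T.card := by
  let f : Fin a × Fin b → ℕ := fun p =>
    if (p.2 : ℕ) ≤ p.1 then (p.1 : ℕ) - p.2 else (p.1 : ℕ) + a - p.2
  have hf : ∀ p ∈ S, f p ∈ Finset.range a := by
    intro p _
    have h1 := p.1.isLt
    simp only [f, Finset.mem_range]
    split_ifs <;> omega
  obtain rfl | ha := Nat.eq_zero_or_pos a
  · exact ⟨S, subset_rfl, fun p => p.1.elim0, fun p => p.1.elim0, by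
      rw [Finset.eq_empty_of_forall_notMem (s := S) fun p => p.1.elim0]; simp⟩
  obtain ⟨d, -, hd⟩ : ∃ d ∈ Finset.range a, S.card ≤ a * (S.filter fun p => f p = d).card := by
    by_contra! h
    have h1 := Finset.sum_lt_sum_of_nonempty (Finset.nonempty_range_iff.2 ha.ne') h
    rw [← Finset.mul_sum, ← Finset.card_eq_sum_card_fiberwise hf] at h1
    simp at h1
  refine ⟨S.filter fun p => f p = d, Finset.filter_subset _ _, ?_, ?_, hd⟩
  all_goals
    rintro ⟨r, c⟩ hp ⟨r', c'⟩ hq h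
    have hp := (Finset.mem_filter.1 hp).2
    have hq := (Finset.mem_filter.1 hq).2
    have h1 := r.isLt
    have h2 := r'.isLt
    have h3 := c.isLt
    have h4 := c'.isLt
    simp only [f] at hp hq h
    simp only [Prod.mk.injEq, Fin.ext_iff, h, true_and, and_true]
    subst h
    split_ifs at hp hq <;> omega

/-- Every weight gives a word whose rank in block `i` is at least the number of leading positions
in block `i`, divided by `m i`. -/
theorem exists_ncard_leadingSet_le_rank {F : Type*} [Field F] {ℓ : ℕ} {m n : Fin ℓ → ℕ}
    (hnm : ∀ i, n i ≤ m i) {a : (Σ i, Fin (m i)) → ℕ} {b : (Σ i, Fin (n i)) → ℕ}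
    (hw : Function.Injective (positionWeight a b)) (C : Submodule F (SumRankSpace F m n)) :
    ∃ X ∈ C, ∀ i,
      (Sigma.mk i ⁻¹' leadingSet entries (positionWeight a b) C).ncard ≤ m i * (X i).rank := by
  classical
  choose T hTS hrow hcol hcard using fun i => exists_diagonal_subset (hnm i)
    (Set.toFinite (Sigma.mk i ⁻¹' leadingSet entries (positionWeight a b) C)).toFinset
  obtain ⟨X, hX, hr⟩ := exists_card_le_rank hw C T hrow hcol fun i p hp => by
    simpa using hTS i hp
  refine ⟨X, hX, fun i => ?_⟩
  rw [Set.ncard_eq_toFinset_card _ (Set.toFinite _)]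
  exact (hcard i).trans (Nat.mul_le_mul_left _ (hr i))

theorem Set.ncard_eq_sum_ncard_preimage_mk {ι : Type*} [Fintype ι] {P : ι → Type*}
    [∀ i, Finite (P i)] (S : Set (Σ i, P i)) :
    S.ncard = ∑ i, (Sigma.mk i ⁻¹' S).ncard := by
  classical
  have h : S.toFinite.toFinset =
      Finset.univ.sigma fun i => (Sigma.mk i ⁻¹' S).toFinite.toFinset := by
    ext ⟨i, p⟩
    simp
  rw [Set.ncard_eq_toFinset_card S, h, Finset.card_sigma]
  exact Finset.sum_congr rfl fun i _ => (Set.ncard_eq_toFinset_card _ _).symm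

/-! ### Weights that insert all other blocks between two entries of one block -/

theorem Nat.mul_add_eq_mul_add {N x y c d : ℕ} (hc : c < N) (hd : d < N)
    (h : N * x + c = N * y + d) : x = y ∧ c = d := by
  have h1 := congrArg (· / N) h
  have h2 := congrArg (· % N) h
  simpa [Nat.mul_add_div (Nat.zero_lt_of_lt hc), Nat.div_eq_of_lt, Nat.mod_eq_of_lt, hc, hd]
    using And.intro h1 h2

/-- The position of an entry of a matrix when its entries are listed row by row, with room for `N`
entries in each row. -/
def rowMajor {a b : ℕ} (N : ℕ) (p : Fin a × Fin b) : ℕ :=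
  N * p.1 + p.2

theorem rowMajor_injective {a b N : ℕ} (hN : b ≤ N) :
    Function.Injective (rowMajor N : Fin a × Fin b → ℕ) := by
  rintro ⟨r, c⟩ ⟨r', c'⟩ h
  have := Nat.mul_add_eq_mul_add (c.isLt.trans_le hN) (c'.isLt.trans_le hN) h
  exact Prod.ext (Fin.ext this.1) (Fin.ext this.2)

/-- The unit of the weights described at `cutRow`: the weights of all positions outside the
distinguished block lie in one interval of this length. -/
def cutScale {ℓ : ℕ} (m n : Fin ℓ → ℕ) : ℕ :=
  (∑ j, n j) * Fintype.card (Σ j, Fin (m j))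

/-- The row part of a weight for which, in block `i`, the entries with `rowMajor` number less than
`t` come first, then all the other blocks, and then the remaining entries of block `i`. -/
noncomputable def cutRow {ℓ : ℕ} (m n : Fin ℓ → ℕ) (i : Fin ℓ) (t : ℕ) (x : Σ j, Fin (m j)) : ℕ :=
  if x.1 = i then cutScale m n * (2 * ((∑ j, n j) * x.2) + 1)
  else cutScale m n * (2 * t) + (∑ j, n j) * Fintype.equivFin (Σ j, Fin (m j)) x

/-- The column part of the weight described at `cutRow`. -/
def cutCol {ℓ : ℕ} (m n : Fin ℓ → ℕ) (i : Fin ℓ) (y : Σ j, Fin (n j)) : ℕ :=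
  if y.1 = i then cutScale m n * (2 * y.2) else y.2

/-- The weight described at `cutRow`. -/
noncomputable def cutWeight {ℓ : ℕ} (m n : Fin ℓ → ℕ) (i : Fin ℓ) (t : ℕ) : Position m n → ℕ :=
  positionWeight (cutRow m n i t) (cutCol m n i)

theorem cutWeight_same {ℓ : ℕ} {m n : Fin ℓ → ℕ} (i : Fin ℓ) (t : ℕ)
    (p : Fin (m i) × Fin (n i)) :
    cutWeight m n i t ⟨i, p⟩ = cutScale m n * (2 * rowMajor (∑ j, n j) p + 1) := by
  simp only [cutWeight, positionWeight, cutRow, cutCol, rowMajor, if_true]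
  ring

theorem le_sum_cols {ℓ : ℕ} (n : Fin ℓ → ℕ) (i : Fin ℓ) : n i ≤ ∑ j, n j :=
  Finset.single_le_sum (fun _ _ => Nat.zero_le _) (Finset.mem_univ i)

/-- Outside block `i` the weight is a row-by-row number below `cutScale m n`, shifted by a
constant. -/
theorem cutWeight_ne {ℓ : ℕ} {m n : Fin ℓ → ℕ} {i : Fin ℓ} (t : ℕ) (q : Position m n)
    (h : q.1 ≠ i) :
    ∃ x < cutScale m n, cutWeight m n i t q = cutScale m n * (2 * t) + x ∧
      x = (∑ j, n j) * Fintype.equivFin (Σ j, Fin (m j)) ⟨q.1, q.2.1⟩ + q.2.2 := by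
  refine ⟨_, ?_, ?_, rfl⟩
  · have h1 : (q.2.2 : ℕ) < ∑ j, n j := q.2.2.isLt.trans_le (le_sum_cols n q.1)
    have h2 := (Fintype.equivFin (Σ j, Fin (m j)) ⟨q.1, q.2.1⟩).isLt
    calc _ < (∑ j, n j) * (Fintype.equivFin (Σ j, Fin (m j)) ⟨q.1, q.2.1⟩ + 1) := by
          rw [mul_add_one]; omega
      _ ≤ _ := Nat.mul_le_mul_left _ h2
  · simp only [cutWeight, positionWeight, cutRow, cutCol, if_neg h]
    ring

theorem cutScale_pos {ℓ : ℕ} {m n : Fin ℓ → ℕ} (q : Position m n) : 0 < cutScale m n :=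
  Nat.mul_pos ((Nat.zero_le _).trans_lt (q.2.2.isLt.trans_le (le_sum_cols n q.1)))
    (Fintype.card_pos_iff.2 ⟨⟨q.1, q.2.1⟩⟩)

theorem cutWeight_injective {ℓ : ℕ} (m n : Fin ℓ → ℕ) (i : Fin ℓ) (t : ℕ) :
    Function.Injective (cutWeight m n i t) := by
  have hmix : ∀ (p : Fin (m i) × Fin (n i)) (q : Position m n), q.1 ≠ i →
      cutWeight m n i t ⟨i, p⟩ ≠ cutWeight m n i t q := by
    intro p q hq h
    obtain ⟨x, hx, hxq, -⟩ := cutWeight_ne t q hq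
    rw [cutWeight_same, hxq] at h
    have := (Nat.mul_add_eq_mul_add (cutScale_pos q) hx ((Nat.add_zero _).trans h)).1
    omega
  rintro ⟨j, p⟩ ⟨j', q⟩ h
  by_cases hj : j = i <;> by_cases hj' : j' = i
  · subst hj
    subst hj'
    rw [cutWeight_same, cutWeight_same] at h
    have := Nat.eq_of_mul_eq_mul_left (cutScale_pos (⟨_, p⟩ : Position m n)) h
    rw [rowMajor_injective (le_sum_cols n _) (show rowMajor _ p = rowMajor _ q by omega)]
  · subst hj
    exact absurd h (hmix p _ hj')
  · subst hj'
    exact absurd h.symm (hmix q _ hj)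
  · obtain ⟨x, -, hx, rfl⟩ := cutWeight_ne t ⟨j, p⟩ hj
    obtain ⟨y, -, hy, rfl⟩ := cutWeight_ne t ⟨j', q⟩ hj'
    rw [hx, hy] at h
    have := Nat.mul_add_eq_mul_add (p.2.isLt.trans_le (le_sum_cols n j))
      (q.2.isLt.trans_le (le_sum_cols n j')) (Nat.add_left_cancel h)
    have hrow := (Fintype.equivFin _).injective (Fin.ext this.1)
    obtain rfl : j = j' := congrArg Sigma.fst hrow
    have h1 : p.1 = q.1 := by simpa using hrow
    rw [Prod.ext h1 (Fin.ext this.2)]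

/-- The sum-rank anticode bound. -/
theorem exists_finrank_le_sum_rank {F : Type*} [Field F] {ℓ : ℕ} {m n : Fin ℓ → ℕ}
    (hℓ : 0 < ℓ) (hnm : ∀ i, n i ≤ m i) (C : Submodule F (SumRankSpace F m n)) :
    ∃ X ∈ C, Module.finrank F C ≤ ∑ i, m i * (X i).rank := by
  have hw := cutWeight_injective m n ⟨0, hℓ⟩ 0
  obtain ⟨X, hX, h⟩ := exists_ncard_leadingSet_le_rank hnm hw C
  refine ⟨X, hX, (finrank_le_ncard_leadingSet (w := cutWeight m n ⟨0, hℓ⟩ 0)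
    entries_injective C).trans ?_⟩
  rw [Set.ncard_eq_sum_ncard_preimage_mk]
  exact Finset.sum_le_sum fun i _ => h i

/-- For an optimal anticode, all the inequalities in the anticode bound are equalities. -/
theorem IsOptimalSumRankAnticode.dvd_ncard_leadingSet {F : Type*} [Field F] {ℓ : ℕ}
    {m n : Fin ℓ → ℕ} (hnm : ∀ i, n i ≤ m i) {C : Submodule F (SumRankSpace F m n)}
    (hC : IsOptimalSumRankAnticode C) {a : (Σ i, Fin (m i)) → ℕ} {b : (Σ i, Fin (n i)) → ℕ}
    (hw : Function.Injective (positionWeight a b)) (i : Fin ℓ) :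
    m i ∣ (Sigma.mk i ⁻¹' leadingSet entries (positionWeight a b) C).ncard := by
  obtain ⟨X, hX, h⟩ := exists_ncard_leadingSet_le_rank hnm hw C
  have h1 := (finrank_le_ncard_leadingSet (w := positionWeight a b) entries_injective C)
  rw [Set.ncard_eq_sum_ncard_preimage_mk] at h1
  have h2 : ∑ i, m i * (X i).rank ≤ Module.finrank F C := hC.2 ⟨X, hX, rfl⟩
  have h3 := (Finset.sum_eq_sum_iff_of_le fun i _ => h i).1
    (le_antisymm (Finset.sum_le_sum fun i _ => h i) (h2.trans h1))
  exact ⟨_, h3 i (Finset.mem_univ i)⟩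

/-! ### Splitting off the blocks with more than one row -/

theorem mk_mem_leadingSet_cutWeight {F : Type*} [Field F] {ℓ : ℕ} {m n : Fin ℓ → ℕ}
    {C : Submodule F (SumRankSpace F m n)} {i : Fin ℓ} {t : ℕ} {p : Fin (m i) × Fin (n i)} :
    (⟨i, p⟩ : Position m n) ∈ leadingSet entries (cutWeight m n i t) C ↔
      ∃ A ∈ C, A i p.1 p.2 ≠ 0 ∧
        (∀ q : Fin (m i) × Fin (n i), rowMajor (∑ j, n j) q < rowMajor (∑ j, n j) p →
          A i q.1 q.2 = 0) ∧
        (t ≤ rowMajor (∑ j, n j) p → ∀ j ≠ i, A j = 0) := by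
  have hpos := cutScale_pos (⟨i, p⟩ : Position m n)
  refine exists_congr fun A => and_congr_right fun _ => and_congr_right fun _ => ?_
  have hsame : ∀ q : Fin (m i) × Fin (n i),
      cutWeight m n i t ⟨i, q⟩ < cutWeight m n i t ⟨i, p⟩ ↔
        rowMajor (∑ j, n j) q < rowMajor (∑ j, n j) p := by
    intro q
    rw [cutWeight_same, cutWeight_same, Nat.mul_lt_mul_left hpos]
    omega
  have hother : ∀ q : Position m n, q.1 ≠ i →
      (cutWeight m n i t q < cutWeight m n i t ⟨i, p⟩ ↔ t ≤ rowMajor (∑ j, n j) p) := by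
    intro q hq
    obtain ⟨x, hx, hxq, -⟩ := cutWeight_ne t q hq
    rw [hxq, cutWeight_same]
    constructor
    · intro h
      have := Nat.lt_of_mul_lt_mul_left ((Nat.le_add_right _ _).trans_lt h)
      omega
    · intro h
      calc _ < cutScale m n * (2 * t + 1) := by rw [mul_add_one]; omega
        _ ≤ _ := Nat.mul_le_mul_left _ (by omega)
  constructor
  · refine fun h => ⟨fun q hq => h ⟨i, q⟩ ((hsame q).2 hq), fun ht j hj => ?_⟩
    ext r c
    exact h ⟨j, r, c⟩ ((hother ⟨j, r, c⟩ hj).2 ht)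
  · rintro ⟨h1, h2⟩ ⟨j, q⟩ hq
    by_cases hj : j = i
    · subst hj
      exact h1 q ((hsame q).1 hq)
    · change A j q.1 q.2 = 0
      rw [h2 ((hother ⟨j, q⟩ hj).1 hq) j hj]
      rfl

theorem Set.ncard_eq_of_diff_subsingleton {α : Type*} [Finite α] {S T U : Set α} {d : ℕ}
    (hd : 1 < d) (hS : d ∣ S.ncard) (hT : d ∣ T.ncard) (hU : U.Subsingleton)
    (h : S \ U = T \ U) : S.ncard = T.ncard := by
  have hU1 : U.ncard ≤ 1 := Set.ncard_le_one_iff_subsingleton.2 hU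
  have h1 := Set.ncard_le_ncard_sdiff_add_ncard S U
  have h2 := Set.ncard_le_ncard_sdiff_add_ncard T U
  have h3 := Set.ncard_le_ncard (Set.sdiff_subset : S \ U ⊆ S)
  have h4 := Set.ncard_le_ncard (Set.sdiff_subset : T \ U ⊆ T)
  rw [h] at h1 h3
  obtain ⟨x, hx⟩ := hS
  obtain ⟨y, hy⟩ := hT
  by_contra hne
  have hxy : x ≠ y := fun h => hne (by rw [hx, hy, h])
  rcases Nat.lt_or_gt_of_ne hxy with hlt | hlt
  · have := Nat.mul_le_mul_left d (Nat.succ_le_of_lt hlt)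
    rw [Nat.mul_succ] at this
    omega
  · have := Nat.mul_le_mul_left d (Nat.succ_le_of_lt hlt)
    rw [Nat.mul_succ] at this
    omega

/-- If `m i > 1`, an optimal anticode contains the projection of each of its words to block `i`.
Moving the other blocks past a single entry of block `i` changes the set of leading positions in
block `i` by at most one element, while its size stays a multiple of `m i`; so the size does
not change at all. With the other blocks first, it is the dimension of the subcode supported in block
`i`, and with the other blocks last, that of the projection to block `i`. -/
theorem IsOptimalSumRankAnticode.single_mem {F : Type*} [Field F] {ℓ : ℕ}
    {m n : Fin ℓ → ℕ} (hnm : ∀ i, n i ≤ m i) {C : Submodule F (SumRankSpace F m n)}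
    (hC : IsOptimalSumRankAnticode C) {i : Fin ℓ} (hi : 1 < m i) {X : SumRankSpace F m n}
    (hX : X ∈ C) : Pi.single i (X i) ∈ C := by
  let N := ∑ j, n j
  let S : ℕ → Set (Fin (m i) × Fin (n i)) := fun t =>
    {p | (⟨i, p⟩ : Position m n) ∈ leadingSet entries (cutWeight m n i t) C}
  have hdvd : ∀ t, m i ∣ (S t).ncard := fun t =>
    hC.dvd_ncard_leadingSet hnm (cutWeight_injective m n i t) i
  have hstep : ∀ t, (S t).ncard = (S (t + 1)).ncard := by
    intro t
    refine Set.ncard_eq_of_diff_subsingleton (U := {p | rowMajor N p = t}) hi (hdvd _) (hdvd _)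
      (fun p hp q hq => rowMajor_injective (le_sum_cols n i) (hp.trans hq.symm)) ?_
    ext p
    refine and_congr_left fun hp => ?_
    have hcut : t ≤ rowMajor N p ↔ t + 1 ≤ rowMajor N p := by
      have : rowMajor N p ≠ t := hp
      omega
    simp only [S, Set.mem_ofPred_eq, mk_mem_leadingSet_cutWeight]
    rw [show (t ≤ rowMajor (∑ j, n j) p) = (t + 1 ≤ rowMajor (∑ j, n j) p) from propext hcut]
  have hconst : ∀ t, (S 0).ncard = (S t).ncard := by
    intro t
    induction t with
    | zero => rfl
    | succ t ih => rw [ih, hstep]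
  let φ : Matrix (Fin (m i)) (Fin (n i)) F →ₗ[F] Fin (m i) × Fin (n i) → F :=
    { toFun := fun A p => A p.1 p.2
      map_add' := fun _ _ => rfl
      map_smul' := fun _ _ => rfl }
  have hφ : Function.Injective φ := fun A B h => by
    ext r c
    exact congrFun h (r, c)
  let D := C.comap (LinearMap.single F (fun j => Matrix (Fin (m j)) (Fin (n j)) F) i)
  let E := C.map (LinearMap.proj (φ := fun j => Matrix (Fin (m j)) (Fin (n j)) F) i)
  have hDE : D ≤ E := fun A hA => ⟨Pi.single i A, hA, by simp⟩
  have h0 : S 0 ⊆ leadingSet φ (rowMajor N) D := by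
    intro p hp
    obtain ⟨A, hA, h1, h2, h3⟩ := mk_mem_leadingSet_cutWeight.1 hp
    refine ⟨A i, ?_, h1, h2⟩
    have : Pi.single i (A i) = A := by
      funext j
      by_cases hj : j = i
      · subst hj
        simp
      · rw [Pi.single_eq_of_ne hj, h3 (Nat.zero_le _) j hj]
    change Pi.single i (A i) ∈ C
    rwa [this]
  -- A cut after the last entry of block `i`.
  have hlast : leadingSet φ (rowMajor N) E ⊆ S (N * m i + N) := by
    rintro p ⟨-, ⟨A, hA, rfl⟩, h1, h2⟩
    refine mk_mem_leadingSet_cutWeight.2 ⟨A, hA, h1, h2, fun ht => ?_⟩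
    have hr : N * p.1 ≤ N * m i := Nat.mul_le_mul_left _ p.1.isLt.le
    have hc : (p.2 : ℕ) < N := p.2.isLt.trans_le (le_sum_cols n i)
    change N * m i + N ≤ N * p.1 + p.2 at ht
    omega
  have hfin : Module.finrank F E ≤ Module.finrank F D :=
    calc _ ≤ _ := finrank_le_ncard_leadingSet (w := rowMajor N) hφ E
      _ ≤ _ := Set.ncard_le_ncard hlast
      _ = _ := (hconst _).symm
      _ ≤ _ := Set.ncard_le_ncard h0
      _ ≤ _ := ncard_leadingSet_le_finrank (rowMajor_injective (le_sum_cols n i)) D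
  have hmem : X i ∈ E := ⟨X, hX, rfl⟩
  rw [← Submodule.eq_of_le_of_finrank_le hDE hfin] at hmem
  exact hmem

/-! ### Product codes -/

theorem one_lt_size_headIdx {ℓ : ℕ} {m : Fin ℓ → ℕ} (hm : Antitone m) (i : Fin (lastBig m)) :
    1 < m (headIdx m i) := by
  have hi : (i : ℕ) < lastBig m := i.isLt
  obtain ⟨j, hj, hij⟩ := Finset.lt_sup_iff.1 hi
  have hle : headIdx m i ≤ j := by
    rw [Fin.le_def]
    change (i : ℕ) ≤ j
    omega
  exact (Finset.mem_filter.1 hj).2.trans_le (hm hle)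

theorem eq_headIdx_or_eq_tailIdx {ℓ : ℕ} (m : Fin ℓ → ℕ) (j : Fin ℓ) :
    (∃ i, j = headIdx m i) ∨ ∃ t, j = tailIdx m t := by
  by_cases h : (j : ℕ) < lastBig m
  · exact Or.inl ⟨⟨j, h⟩, rfl⟩
  · refine Or.inr ⟨⟨j - lastBig m, by omega⟩, Fin.ext ?_⟩
    simp only [tailIdx]
    omega

theorem headIdx_injective {ℓ : ℕ} (m : Fin ℓ → ℕ) : Function.Injective (headIdx m) :=
  Fin.castLE_injective (lastBig_le m)

theorem tailIdx_injective {ℓ : ℕ} (m : Fin ℓ → ℕ) : Function.Injective (tailIdx m) := by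
  intro s t h
  have := congrArg Fin.val h
  simp only [tailIdx] at this
  exact Fin.ext (by omega)

theorem headIdx_ne_tailIdx {ℓ : ℕ} (m : Fin ℓ → ℕ) (i : Fin (lastBig m))
    (t : Fin (ℓ - lastBig m)) : headIdx m i ≠ tailIdx m t := by
  intro h
  have := congrArg Fin.val h
  simp only [tailIdx, headIdx, Fin.val_castLE] at this
  have := i.isLt
  omega

theorem sum_eq_sum_headIdx_add_sum_tailIdx {ℓ : ℕ} (m : Fin ℓ → ℕ) (f : Fin ℓ → ℕ) :
    ∑ j, f j = ∑ i, f (headIdx m i) + ∑ t, f (tailIdx m t) := by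
  have hbij : Function.Bijective (Sum.elim (headIdx m) (tailIdx m)) := by
    refine ⟨(headIdx_injective m).sumElim (tailIdx_injective m) (headIdx_ne_tailIdx m),
      fun j => ?_⟩
    rcases eq_headIdx_or_eq_tailIdx m j with ⟨i, rfl⟩ | ⟨t, rfl⟩
    · exact ⟨Sum.inl i, rfl⟩
    · exact ⟨Sum.inr t, rfl⟩
  rw [← (Equiv.ofBijective _ hbij).sum_comp f, Fintype.sum_sum_type]
  rfl

theorem ext_one_by_one {F : Type*} {a b : ℕ} [NeZero a] [NeZero b] (ha : a = 1)
    (hb : b = 1) {A B : Matrix (Fin a) (Fin b) F} (h : A 0 0 = B 0 0) : A = B := by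
  subst ha
  subst hb
  ext r c
  rwa [Subsingleton.elim r 0, Subsingleton.elim c 0]

open Classical in
theorem rank_one_by_one {F : Type*} [Field F] {a b : ℕ} [NeZero a] [NeZero b] (ha : a = 1)
    (hb : b = 1) (A : Matrix (Fin a) (Fin b) F) : A.rank = if A 0 0 ≠ 0 then 1 else 0 := by
  split_ifs with h
  · subst ha
    subst hb
    have hdet : A.det ≠ 0 := by
      rwa [Matrix.det_fin_one, Subsingleton.elim (0 : Fin 1) 0]
    rw [Matrix.rank_of_det_ne_zero hdet, Fintype.card_fin]
  · have hA : A = 0 := ext_one_by_one ha hb (not_not.1 h)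
    rw [hA, Matrix.rank_zero]

open Classical in
theorem sum_rank_eq_sum_add_hammingNorm {F : Type*} [Field F] {ℓ : ℕ} {m n : Fin ℓ → ℕ}
    [∀ i, NeZero (m i)] [∀ i, NeZero (n i)] (hnm : ∀ i, n i ≤ m i) (X : SumRankSpace F m n) :
    ∑ j, m j * (X j).rank =
      ∑ i, m (headIdx m i) * (X (headIdx m i)).rank + hammingNorm (tailVec X) := by
  rw [sum_eq_sum_headIdx_add_sum_tailIdx m, hammingNorm, Finset.card_filter]
  congr 1
  refine Finset.sum_congr rfl fun t _ => ?_
  obtain ⟨h1, h2⟩ := size_tailIdx m n hnm t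
  calc m (tailIdx m t) * (X (tailIdx m t)).rank = 1 * (X (tailIdx m t)).rank :=
        congrArg (· * (X (tailIdx m t)).rank) h1
    _ = _ := by
        rw [rank_one_by_one h1 h2, one_mul]
        rfl

/-- The blocks before and after the `k`-th one can be prescribed independently. -/
theorem exists_head_tail_eq {F : Type*} [Field F] {ℓ : ℕ} {m n : Fin ℓ → ℕ}
    [∀ i, NeZero (m i)] [∀ i, NeZero (n i)]
    (Y : ∀ i : Fin (lastBig m), Matrix (Fin (m (headIdx m i))) (Fin (n (headIdx m i))) F)
    (y : Fin (ℓ - lastBig m) → F) :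
    ∃ X : SumRankSpace F m n, (∀ i, X (headIdx m i) = Y i) ∧ tailVec X = y := by
  let U : SumRankSpace F m n := ∑ i, Pi.single (headIdx m i) (Y i)
  let V : SumRankSpace F m n := ∑ t, Pi.single (tailIdx m t) (Matrix.of fun _ _ => y t)
  refine ⟨U + V, fun i => ?_, funext fun t => ?_⟩
  · have hU : U (headIdx m i) = Y i := by
      simp only [U]
      rw [Finset.sum_apply, Finset.sum_eq_single i, Pi.single_eq_same]
      · exact fun j _ hj => Pi.single_eq_of_ne (fun h => hj (headIdx_injective m h).symm) _
      · simp
    have hV : V (headIdx m i) = 0 := by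
      simp only [V]
      rw [Finset.sum_apply]
      exact Finset.sum_eq_zero fun t _ => Pi.single_eq_of_ne (headIdx_ne_tailIdx m i t) _
    rw [Pi.add_apply, hU, hV, add_zero]
  · have hU : U (tailIdx m t) = 0 := by
      simp only [U]
      rw [Finset.sum_apply]
      exact Finset.sum_eq_zero fun i _ => Pi.single_eq_of_ne (headIdx_ne_tailIdx m i t).symm _
    have hV : V (tailIdx m t) = Matrix.of fun _ _ => y t := by
      simp only [V]
      rw [Finset.sum_apply, Finset.sum_eq_single t, Pi.single_eq_same]
      · exact fun j _ hj => Pi.single_eq_of_ne (fun h => hj (tailIdx_injective m h).symm) _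
      · simp
    change (U + V) (tailIdx m t) 0 0 = y t
    rw [Pi.add_apply, hU, hV, zero_add]
    rfl

theorem eq_of_head_eq_of_tailVec_eq {F : Type*} [Field F] {ℓ : ℕ} {m n : Fin ℓ → ℕ}
    [∀ i, NeZero (m i)] [∀ i, NeZero (n i)] (hnm : ∀ i, n i ≤ m i) {X Y : SumRankSpace F m n}
    (hhead : ∀ i, X (headIdx m i) = Y (headIdx m i)) (htail : tailVec X = tailVec Y) :
    X = Y := by
  funext j
  rcases eq_headIdx_or_eq_tailIdx m j with ⟨i, rfl⟩ | ⟨t, rfl⟩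
  · exact hhead i
  · obtain ⟨h1, h2⟩ := size_tailIdx m n hnm t
    exact ext_one_by_one h1 h2 (congrFun htail t)

theorem finrank_prodCode {F : Type*} [Field F] {ℓ : ℕ} {m n : Fin ℓ → ℕ}
    [∀ i, NeZero (m i)] [∀ i, NeZero (n i)] (hnm : ∀ i, n i ≤ m i)
    (D : (i : Fin (lastBig m)) →
      Submodule F (Matrix (Fin (m (headIdx m i))) (Fin (n (headIdx m i))) F))
    (C' : Submodule F (Fin (ℓ - lastBig m) → F)) :
    Module.finrank F (prodCode (n := n) D C') =
      ∑ i, Module.finrank F (D i) + Module.finrank F C' := by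
  let f : prodCode (n := n) D C' →ₗ[F] (∀ i, D i) × C' :=
    { toFun := fun X => (fun i => ⟨X.1 (headIdx m i), X.2.1 i⟩, ⟨tailVec X.1, X.2.2⟩)
      map_add' := fun _ _ => rfl
      map_smul' := fun _ _ => rfl }
  have hf : Function.Bijective f := by
    constructor
    · intro X Y h
      refine Subtype.ext (eq_of_head_eq_of_tailVec_eq hnm (fun i => ?_) ?_)
      · exact congrArg Subtype.val (congrFun (congrArg Prod.fst h) i)
      · exact congrArg Subtype.val (congrArg Prod.snd h)
    · rintro ⟨Y, y⟩
      obtain ⟨X, hX, hx⟩ := exists_head_tail_eq (n := n) (fun i => (Y i).1) y.1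
      refine ⟨⟨X, fun i => ?_, ?_⟩, ?_⟩
      · rw [hX i]
        exact (Y i).2
      · rw [hx]
        exact y.2
      · exact Prod.ext (funext fun i => Subtype.ext (hX i)) (Subtype.ext hx)
  rw [(LinearEquiv.ofBijective f hf).finrank_eq, Module.finrank_prod,
    Module.finrank_pi_fintype]

/-- The rank-metric anticode bound, for a code placed in one block. -/
theorem exists_finrank_le_mul_rank {F : Type*} [Field F] {a b : ℕ} (hba : b ≤ a)
    (D : Submodule F (Matrix (Fin a) (Fin b) F)) :
    ∃ Y ∈ D, Module.finrank F D ≤ a * Y.rank := by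
  let f := LinearMap.single F (fun _ : Fin 1 => Matrix (Fin a) (Fin b) F) 0
  have hf : Function.Injective f :=
    Pi.single_injective (M := fun _ : Fin 1 => Matrix (Fin a) (Fin b) F) 0
  obtain ⟨X, ⟨Y, hY, rfl⟩, h⟩ := exists_finrank_le_sum_rank (m := fun _ => a) (n := fun _ => b)
    one_pos (fun _ => hba) (D.map f)
  rw [← (Submodule.equivMapOfInjective f hf _).finrank_eq] at h
  exact ⟨Y, hY, by simpa [f] using h⟩

open Classical in
/-- The Hamming-metric anticode bound. -/
theorem exists_finrank_le_hammingNorm {F : Type*} [Field F] {r : ℕ}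
    (C : Submodule F (Fin r → F)) : ∃ x ∈ C, Module.finrank F C ≤ hammingNorm x := by
  obtain rfl | hr := Nat.eq_zero_or_pos r
  · exact ⟨0, C.zero_mem, by simp [Module.finrank_zero_of_subsingleton]⟩
  let f : (Fin r → F) →ₗ[F] SumRankSpace F (fun _ : Fin r => 1) (fun _ => 1) :=
    { toFun := fun x i => Matrix.of fun _ _ => x i
      map_add' := fun _ _ => rfl
      map_smul' := fun _ _ => rfl }
  have hf : Function.Injective f := fun x y h =>
    funext fun i => congrFun (congrFun (congrFun h i) 0) 0
  obtain ⟨X, ⟨x, hx, rfl⟩, h⟩ := exists_finrank_le_sum_rank hr (fun _ => le_rfl) (C.map f)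
  rw [← (Submodule.equivMapOfInjective f hf _).finrank_eq] at h
  refine ⟨x, hx, h.trans_eq ?_⟩
  rw [hammingNorm, Finset.card_filter]
  refine Finset.sum_congr rfl fun i _ => ?_
  rw [one_mul, rank_one_by_one rfl rfl]
  rfl

open Classical in
theorem isOptimalSumRankAnticode_prodCode {F : Type*} [Field F] {ℓ : ℕ} {m n : Fin ℓ → ℕ}
    [∀ i, NeZero (m i)] [∀ i, NeZero (n i)] (hnm : ∀ i, n i ≤ m i)
    {D : (i : Fin (lastBig m)) →
      Submodule F (Matrix (Fin (m (headIdx m i))) (Fin (n (headIdx m i))) F)}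
    {C' : Submodule F (Fin (ℓ - lastBig m) → F)} (hD : ∀ i, IsOptimalRankAnticode (D i))
    (hC' : IsOptimalHammingAnticode C') :
    IsOptimalSumRankAnticode (prodCode (n := n) D C') := by
  rw [IsOptimalSumRankAnticode, finrank_prodCode hnm]
  constructor
  · choose Y hYD hY using fun i => (hD i).1
    obtain ⟨y, hyC, hy⟩ := hC'.1
    obtain ⟨X, hX, hx⟩ := exists_head_tail_eq (n := n) Y y
    refine ⟨X, ⟨fun i => hX i ▸ hYD i, hx ▸ hyC⟩, ?_⟩
    rw [sum_rank_eq_sum_add_hammingNorm hnm, hx, hy]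
    simp only [hX, hY]
  · rintro w ⟨X, hX, rfl⟩
    rw [sum_rank_eq_sum_add_hammingNorm hnm]
    exact add_le_add (Finset.sum_le_sum fun i _ => (hD i).2 ⟨_, hX.1 i, rfl⟩)
      (hC'.2 ⟨_, hX.2, rfl⟩)

open Classical in
/-- By the anticode bounds for the factors, the bound for the product can be attained only if it is
attained for each factor. -/
theorem IsOptimalSumRankAnticode.of_prodCode {F : Type*} [Field F] {ℓ : ℕ} {m n : Fin ℓ → ℕ}
    [∀ i, NeZero (m i)] [∀ i, NeZero (n i)] (hnm : ∀ i, n i ≤ m i)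
    {D : (i : Fin (lastBig m)) →
      Submodule F (Matrix (Fin (m (headIdx m i))) (Fin (n (headIdx m i))) F)}
    {C' : Submodule F (Fin (ℓ - lastBig m) → F)}
    (hC : IsOptimalSumRankAnticode (prodCode (n := n) D C')) :
    (∀ i, IsOptimalRankAnticode (D i)) ∧ IsOptimalHammingAnticode C' := by
  choose Y hYD hY using fun i => exists_finrank_le_mul_rank (hnm (headIdx m i)) (D i)
  obtain ⟨y, hyC, hy⟩ := exists_finrank_le_hammingNorm C'
  have hub : ∀ Z : ∀ i, Matrix (Fin (m (headIdx m i))) (Fin (n (headIdx m i))) F,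
      (∀ i, Z i ∈ D i) → ∀ z ∈ C',
      ∑ i, m (headIdx m i) * (Z i).rank + hammingNorm z ≤
        ∑ i, Module.finrank F (D i) + Module.finrank F C' := by
    intro Z hZ z hz
    obtain ⟨X, hX, hx⟩ := exists_head_tail_eq (n := n) Z z
    have h := hC.2 ⟨X, ⟨fun i => (hX i).symm ▸ hZ i, hx.symm ▸ hz⟩, rfl⟩
    rw [sum_rank_eq_sum_add_hammingNorm hnm, finrank_prodCode hnm, hx] at h
    simpa only [hX] using h
  have hD : ∀ i, ∀ Z ∈ D i, m (headIdx m i) * Z.rank ≤ Module.finrank F (D i) := by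
    intro i Z hZ
    by_contra! hlt
    have h := hub (Function.update Y i Z) (fun j => by
      by_cases hj : j = i
      · subst hj
        simpa using hZ
      · simpa [hj] using hYD j) y hyC
    have hsum : ∑ j, Module.finrank F (D j) <
        ∑ j, m (headIdx m j) * (Function.update Y i Z j).rank := by
      refine Finset.sum_lt_sum (fun j _ => ?_) ⟨i, Finset.mem_univ i, by simpa using hlt⟩
      by_cases hj : j = i
      · subst hj
        simpa using hlt.le
      · simpa [hj] using hY j
    omega
  have hC'y : ∀ z ∈ C', hammingNorm z ≤ Module.finrank F C' := by
    intro z hz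
    have h1 := hub Y hYD z hz
    have h2 := Finset.sum_le_sum fun i (_ : i ∈ Finset.univ) => hY i
    omega
  refine ⟨fun i => ⟨⟨Y i, hYD i, (hY i).antisymm (hD i _ (hYD i))⟩, ?_⟩,
    ⟨y, hyC, hy.antisymm (hC'y y hyC)⟩, ?_⟩
  · rintro w ⟨Z, hZ, rfl⟩
    exact hD i Z hZ
  · rintro w ⟨z, hz, rfl⟩
    exact hC'y z hz

/-- A code that contains the projections of its words to each of the first `k` blocks is a
product. -/
theorem exists_eq_prodCode {F : Type*} [Field F] {ℓ : ℕ} {m n : Fin ℓ → ℕ}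
    [∀ i, NeZero (m i)] [∀ i, NeZero (n i)] (hnm : ∀ i, n i ≤ m i)
    {C : Submodule F (SumRankSpace F m n)}
    (h : ∀ i, ∀ X ∈ C, Pi.single (headIdx m i) (X (headIdx m i)) ∈ C) :
    ∃ (D : (i : Fin (lastBig m)) →
          Submodule F (Matrix (Fin (m (headIdx m i))) (Fin (n (headIdx m i))) F))
      (C' : Submodule F (Fin (ℓ - lastBig m) → F)), C = prodCode D C' := by
  refine ⟨fun i => C.comap
    (LinearMap.single F (fun j => Matrix (Fin (m j)) (Fin (n j)) F) (headIdx m i)),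
    C.map tailVec, ?_⟩
  refine le_antisymm (fun X hX => ⟨fun i => h i X hX, X, hX, rfl⟩) ?_
  rintro X ⟨hhead, Y, hY, htail⟩
  -- Off the first `k` blocks, `X` agrees with the word `Y` of `C`.
  have hdiff : X - Y ∈ C := by
    rw [← Finset.univ_sum_single (X - Y)]
    refine C.sum_mem fun j _ => ?_
    rcases eq_headIdx_or_eq_tailIdx m j with ⟨i, rfl⟩ | ⟨t, rfl⟩
    · rw [Pi.sub_apply, Pi.single_sub]
      exact C.sub_mem (hhead i) (h i Y hY)
    · obtain ⟨h1, h2⟩ := size_tailIdx m n hnm t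
      rw [Pi.sub_apply, ext_one_by_one h1 h2 (congrFun htail.symm t), sub_self, Pi.single_zero]
      exact C.zero_mem
  simpa using C.add_mem hdiff hY

theorem mainTheorem2 {F : Type*} [Field F] [Finite F] {ℓ : ℕ} (hℓ : 0 < ℓ)
    (m n : Fin ℓ → ℕ) [∀ i, NeZero (m i)] [∀ i, NeZero (n i)]
    (hm : Antitone m) (hnm : ∀ i, n i ≤ m i)
    (C : Submodule F (SumRankSpace F m n)) :
    IsOptimalSumRankAnticode C ↔
      ∃ (D : (i : Fin (lastBig m)) →
          Submodule F (Matrix (Fin (m (headIdx m i))) (Fin (n (headIdx m i))) F))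
        (C' : Submodule F (Fin (ℓ - lastBig m) → F)),
        (∀ i, IsOptimalRankAnticode (D i)) ∧ IsOptimalHammingAnticode C' ∧
          C = prodCode D C' := by
  constructor
  · intro hC
    obtain ⟨D, C', rfl⟩ := exists_eq_prodCode hnm fun i X hX =>
      hC.single_mem hnm (one_lt_size_headIdx hm i) hX
    obtain ⟨h1, h2⟩ := hC.of_prodCode hnm
    exact ⟨D, C', h1, h2, rfl⟩
  · rintro ⟨D, C', hD, hC', rfl⟩
    exact isOptimalSumRankAnticode_prodCode hnm hD hC'
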